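/- **Setting.** Let $N$ be a finite set of players, let $A^i$ ($i\in N$) be finite sets of actions, $A=\prod_{i\in N}A^i$, let $D$ be a finite set of directions of Nature, and $\Gamma=A\times D$ the set of moves. Histories are the words in $\Gamma^*$. A *distributed game* $\mathcal G$ is given by a finite Mealy machine $M^i$ with input alphabet $\Gamma$ and finite output alphabet $B^i$ for each player $i$; two histories are *indistinguishable* for $i$, $\tau\sim^i\tau'$, if $M^i$ outputs the same observation sequence on both. A *winning condition* is given by a nondeterministic parity tree automaton $\mathcal W=(Q,\Delta,q_\varepsilon,\Omega)$ with $Q$ finite, $\Delta\subseteq Q\times A\times Q^D$ and $\Omega:Q\to\mathbb N$. A *decision structure* $S=(V,E,f,v_\varepsilon)$ consists of a (possibly infinite) set $V$ of nodes, an edge relation $E\subseteq V\times D\times V$ that is the graph of a function $V\times D\to V$, a function $f:V\to A$ and an initial node $v_\varepsilon$. Every history $a_0d_0\,a_1d_1\dots a_{\ell-1}d_{\ell-1}$ determines a path $v_\varepsilon=v_0\xrightarrow{d_0}v_1\xrightarrow{d_1}\cdots\xrightarrow{d_{\ell-1}}v_\ell$ in $S$; it *follows* $S$ if $a_k=f(v_k)$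 for all $k<\ell$. Write $v_\tau=v_\ell$ for the end node of the path of $\tau$, and $H_S$ for the set of histories that follow $S$. For nodes $v,v'$ write $v\approx^i v'$ if there are $\tau,\tau'\in H_S$ with $\tau\sim^i\tau'$, $v_\tau=v$ and $v_{\tau'}=v'$. Then $S$ is a *strategy structure* if $v\approx^i v'$ implies $f^i(v)=f^i(v')$, for all $i$, $v$, $v'$. A *run* of $\mathcal W$ on $S$ is a map $r:H_S\to Q$ with $r(\varepsilon)=q_\varepsilon$ and $(r(\tau),a,(r(\tau ad))_{d\in D})\in\Delta$ for all $\tau\in H_S$, where $a=f(v_\tau)$. It is *accepting* if along every infinite play all of whose finite prefixes lie in $H_S$, the least priority $\Omega(r(\cdot))$ that occurs infinitely often is even. A strategy structure is *winning* if $\mathcal W$ has an accepting run on it. A *witness* $(S,\rho)$ is a strategy structure $S$ together with labellings of its nodes $\rho^i:V\to Q^i$ ($Q^i$ being the state set of $M^i$) and $\rho_{\mathcal W}:V\to Q$ such that, for every $\tau\in H_S$, $\rho^i(v_\tau)$ is the state of $M^i$ after reading $\tau$, and such that $\tau\mapsto\rho_{\mathcal W}(v_\tau)$ is an accepting run of $\mathcal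 W$ on $S$. A *d-state* of $(S,\rho)$ is the structure $(V_\kappa,E,(\approx^i)_{i\in N},\rho)$ induced on a maximal connected component $V_\kappa\subseteq V$ of the graph on $V$ with edge relation $\approx\;=\bigcup_{i\in N}\approx^i$. Two d-states are isomorphic ($\cong$) if there is a bijection between their node sets that preserves and reflects $E$ and all $\approx^i$ and preserves $\rho$. **Theorem (Retraction).** Let $\mathcal G$ be a distributed game with winning condition given by a parity tree automaton $\mathcal W$. If there exists a witness $(S,\rho)$ for $\mathcal G$ and $\mathcal W$ in which all d-states are finite and which has only finitely many d-states up to isomorphism, then there exists a winning strategy structure for $\mathcal G$ and $\mathcal W$ with finitely many nodes. -/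

import Mathlib

universe u

/-- A Mealy machine with state set `Q`, input alphabet `X` and output alphabet `B`. -/
structure MealyMachine (Q X B : Type*) where
  step : Q → X → Q
  out : Q → X → B
  init : Q

namespace MealyMachine

variable {Q X B : Type*}

/-- The state in which the run on `τ` ends. The run on `τ` is the sequence of the values of
`state` on the prefixes of `τ`. -/
def state (M : MealyMachine Q X B) (τ : List X) : Q :=
  τ.foldl M.step M.init

/-- The output sequence on the input word, when the machine is started in state `q`. -/
def outputFrom (M : MealyMachine Q X B) : Q → List X → List B
  | _, [] => []
  | q, x :: τ => M.out q x :: M.outputFrom (M.step q x) τ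

def output (M : MealyMachine Q X B) (τ : List X) : List B :=
  M.outputFrom M.init τ

end MealyMachine

/-- The set `Γ = A × D` of moves: an action profile together with a direction chosen by Nature. -/
abbrev Move {N : Type*} (Act : N → Type*) (D : Type*) : Type _ :=
  (∀ i, Act i) × D

/-- A distributed game: one Mealy machine for each player, which reads histories (finite words
of moves) and outputs the observations of the player. -/
structure DistributedGame (N : Type*) (Act : N → Type*) (D : Type*) (Obs St : N → Type*) where
  machine : ∀ i, MealyMachine (St i) (Move Act D) (Obs i)

/-- The histories `τ` and `τ'` are indistinguishable for player `i`. -/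
def DistributedGame.Indist {N : Type*} {Act : N → Type*} {D : Type*} {Obs St : N → Type*}
    (G : DistributedGame N Act D Obs St) (i : N) (τ τ' : List (Move Act D)) : Prop :=
  (G.machine i).output τ = (G.machine i).output τ'

/-- A decision structure on the set `V` of nodes. The edge relation is the graph of a
transition function: there is an edge from `u` to `v` in direction `d` iff `next u d = v`. -/
structure DecisionStructure {N : Type*} (Act : N → Type*) (D V : Type*) where
  next : V → D → V
  act : V → ∀ i, Act i
  init : V

namespace DecisionStructure

variable {N : Type*} {Act : N → Type*} {D V : Type*} {Obs St : N → Type*}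

/-- The last node of the path that corresponds to the history `τ`. -/
def dest (S : DecisionStructure Act D V) (τ : List (Move Act D)) : V :=
  τ.foldl (fun v α => S.next v α.2) S.init

/-- The history `τ` follows `S`: each action profile in `τ` is the one chosen by `S` at the node
reached before. The outcome tree of `S` is the set of these histories. -/
def Follows (S : DecisionStructure Act D V) (τ : List (Move Act D)) : Prop :=
  ∀ (σ : List (Move Act D)) (α : Move Act D), σ ++ [α] <+: τ → α.1 = S.act (S.dest σ)

/-- The history `τ` follows `S` and leads from the initial node to `v`. -/
def Reaches (S : DecisionStructure Act D V) (τ : List (Move Act D)) (v : V) : Prop :=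
  S.Follows τ ∧ S.dest τ = v

/-- The uniformity relation of player `i` on the nodes of `S`. -/
def Approx (G : DistributedGame N Act D Obs St) (S : DecisionStructure Act D V) (i : N)
    (v v' : V) : Prop :=
  ∃ τ τ' : List (Move Act D), G.Indist i τ τ' ∧ S.Reaches τ v ∧ S.Reaches τ' v'

/-- `S` is a strategy structure for `G`. -/
def IsStrategy (G : DistributedGame N Act D Obs St) (S : DecisionStructure Act D V) : Prop :=
  ∀ (i : N) (v v' : V), S.Approx G i v v' → S.act v i = S.act v' i

/-- The union of the uniformity relations of all players. -/
def ApproxUnion (G : DistributedGame N Act D Obs St) (S : DecisionStructure Act D V)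
    (v v' : V) : Prop :=
  ∃ i, S.Approx G i v v'

/-- The node sets of the d-states of `S`, that is, the maximal connected components of the
graph on `V` whose edges are given by `ApproxUnion`. -/
def dStates (G : DistributedGame N Act D Obs St) (S : DecisionStructure Act D V) : Set (Set V) :=
  (Relation.EqvGen.setoid (S.ApproxUnion G)).classes

/-- The infinite sequence `π` of moves is a play through the outcome tree of `S`. -/
def IsPlay (S : DecisionStructure Act D V) (π : ℕ → Move Act D) : Prop :=
  ∀ n, S.Follows ((List.range n).map π)

end DecisionStructure

/-- The parity condition: the minimal priority that appears infinitely often is even. -/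
def ParityCondition (p : ℕ → ℕ) : Prop :=
  ∃ k, IsLeast {k | ∃ᶠ n in Filter.atTop, p n = k} k ∧ Even k

/-- A nondeterministic parity tree automaton with state set `Q`, reading trees that branch over
`D` and are labelled with action profiles. -/
structure ParityTreeAutomaton {N : Type*} (Act : N → Type*) (D Q : Type*) where
  trans : Set (Q × (∀ i, Act i) × (D → Q))
  init : Q
  priority : Q → ℕ

namespace ParityTreeAutomaton

variable {N : Type*} {Act : N → Type*} {D Q V : Type*}

/-- `r` is a run on the outcome of `S`. Only the values of `r` on histories that follow `S`
matter. -/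
def IsRun (W : ParityTreeAutomaton Act D Q) (S : DecisionStructure Act D V)
    (r : List (Move Act D) → Q) : Prop :=
  r [] = W.init ∧ ∀ τ, S.Follows τ →
    (r τ, S.act (S.dest τ), fun d => r (τ ++ [(S.act (S.dest τ), d)])) ∈ W.trans

def IsAcceptingRun (W : ParityTreeAutomaton Act D Q) (S : DecisionStructure Act D V)
    (r : List (Move Act D) → Q) : Prop :=
  W.IsRun S r ∧ ∀ π, S.IsPlay π →
    ParityCondition fun n => W.priority (r ((List.range n).map π))

/-- `S` is winning for `W`. -/
def IsWinning (W : ParityTreeAutomaton Act D Q) (S : DecisionStructure Act D V) : Prop :=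
  ∃ r, W.IsAcceptingRun S r

end ParityTreeAutomaton

/-- An annotated strategy: a strategy structure with a labelling of its nodes by states of the
Mealy machines and of the tree automaton, which describes runs of these machines. -/
structure AnnotatedStrategy {N : Type*} {Act : N → Type*} {D Q : Type*} {Obs St : N → Type*}
    (G : DistributedGame N Act D Obs St) (W : ParityTreeAutomaton Act D Q) (V : Type*)
    extends DecisionStructure Act D V where
  uniform : toDecisionStructure.IsStrategy G
  obsLabel : ∀ i, V → St i
  autLabel : V → Q
  obsLabel_run : ∀ i τ, toDecisionStructure.Follows τ →
    obsLabel i (toDecisionStructure.dest τ) = (G.machine i).state τ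
  autLabel_run : W.IsRun toDecisionStructure fun τ => autLabel (toDecisionStructure.dest τ)

namespace AnnotatedStrategy

variable {N : Type*} {Act : N → Type*} {D Q V : Type*} {Obs St : N → Type*}
  {G : DistributedGame N Act D Obs St} {W : ParityTreeAutomaton Act D Q}

/-- The annotated strategy is a witness: the run described by the annotation is accepting. -/
def IsWitness (S : AnnotatedStrategy G W V) : Prop :=
  W.IsAcceptingRun S.toDecisionStructure fun τ => S.autLabel (S.dest τ)

/-- An isomorphism between the structures induced on the node sets `K` and `L`, in the
signature that consists of the edge relation, the uniformity relations and the annotation. -/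
structure Iso (S : AnnotatedStrategy G W V) (K L : Set V) where
  toEquiv : K ≃ L
  edge_iff : ∀ (u v : K) (d : D), S.next u d = v ↔ S.next (toEquiv u) d = toEquiv v
  approx_iff : ∀ (i : N) (u v : K),
    S.Approx G i u v ↔ S.Approx G i (toEquiv u) (toEquiv v)
  obsLabel_eq : ∀ (i : N) (u : K), S.obsLabel i (toEquiv u) = S.obsLabel i u
  autLabel_eq : ∀ u : K, S.autLabel (toEquiv u) = S.autLabel u

/-- The isomorphism relation on the set of d-states. -/
def isoSetoid (S : AnnotatedStrategy G W V) : Setoid (S.dStates G) where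
  r K L := Nonempty (S.Iso K L)
  iseqv :=
    { refl := fun _ => ⟨⟨Equiv.refl _, fun _ _ _ => Iff.rfl, fun _ _ _ => Iff.rfl,
        fun _ _ => rfl, fun _ => rfl⟩⟩
      symm := by
        rintro K L ⟨e⟩
        refine ⟨⟨e.toEquiv.symm, fun u v d => ?_, fun i u v => ?_, fun i u => ?_, fun u => ?_⟩⟩
        · simpa using (e.edge_iff (e.toEquiv.symm u) (e.toEquiv.symm v) d).symm
        · simpa using (e.approx_iff i (e.toEquiv.symm u) (e.toEquiv.symm v)).symm
        · simpa using (e.obsLabel_eq i (e.toEquiv.symm u)).symm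
        · simpa using (e.autLabel_eq (e.toEquiv.symm u)).symm
      trans := by
        rintro K L M ⟨e⟩ ⟨e'⟩
        exact ⟨⟨e.toEquiv.trans e'.toEquiv,
          fun u v d => (e.edge_iff u v d).trans (e'.edge_iff _ _ d),
          fun i u v => (e.approx_iff i u v).trans (e'.approx_iff i _ _),
          fun i u => (e'.obsLabel_eq i _).trans (e.obsLabel_eq i u),
          fun u => (e'.autLabel_eq _).trans (e.autLabel_eq u)⟩⟩ }

/-- There are finitely many d-states up to isomorphism. -/
def FiniteIndex (S : AnnotatedStrategy G W V) : Prop :=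
  Finite (Quotient S.isoSetoid)

end AnnotatedStrategy

-- The retraction moves along an edge of the witness and then jumps, by an isomorphism of d-states,
-- into a finite family of representative d-states. Isomorphisms preserve labels and `Approx`, so
-- indistinguishable histories of the retract still end in nodes related in `S` (`approx_retract`),
-- and the annotation still describes a run (`isRun_retract`).
--
-- The danger is acceptance: jumps could splice pieces of accepting paths into a play that violates
-- parity. Each odd priority `k` therefore gets an ordinal rank on nodes that, along edges from
-- reachable nodes, does not increase at priorities at least `k` and decreases at `k`
-- (`exists_rank`). Jumps that raise no rank preserve acceptance (`isWinning_retract`). Finitely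
-- many targets suffice for such jumps because ordinal-valued vectors indexed by a finite set are
-- well-quasi-ordered (`exists_finite_basis`).

universe uN uA uD

/-! ### Mealy machines and histories -/

namespace MealyMachine

variable {Q X B : Type*}

theorem outputFrom_concat (M : MealyMachine Q X B) (q : Q) (τ : List X) (x : X) :
    M.outputFrom q (τ ++ [x]) = M.outputFrom q τ ++ [M.out (τ.foldl M.step q) x] := by
  induction τ generalizing q with
  | nil => rfl
  | cons y τ ih => simp [outputFrom, ih]

theorem output_concat (M : MealyMachine Q X B) (τ : List X) (x : X) :
    M.output (τ ++ [x]) = M.output τ ++ [M.out (M.state τ) x] :=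
  M.outputFrom_concat _ _ _

theorem state_concat (M : MealyMachine Q X B) (τ : List X) (x : X) :
    M.state (τ ++ [x]) = M.step (M.state τ) x := by
  simp [state]

end MealyMachine

section History

variable {N : Type*} {Act : N → Type*} {D V : Type*} {Obs St : N → Type*}

theorem DistributedGame.indist_concat_iff (G : DistributedGame N Act D Obs St) (i : N)
    (τ τ' : List (Move Act D)) (α α' : Move Act D) :
    G.Indist i (τ ++ [α]) (τ' ++ [α']) ↔ G.Indist i τ τ' ∧
      (G.machine i).out ((G.machine i).state τ) α =
        (G.machine i).out ((G.machine i).state τ') α' := by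
  simp only [DistributedGame.Indist, MealyMachine.output_concat]
  constructor
  · intro h
    have := List.append_inj' h rfl
    simpa using this
  · rintro ⟨h, h'⟩
    rw [h, h']

namespace DecisionStructure

variable (S : DecisionStructure Act D V)

theorem dest_concat (τ : List (Move Act D)) (α : Move Act D) :
    S.dest (τ ++ [α]) = S.next (S.dest τ) α.2 := by
  simp [dest]

theorem follows_nil : S.Follows [] := by
  intro σ α h
  simp at h

theorem follows_concat_iff (τ : List (Move Act D)) (α : Move Act D) :
    S.Follows (τ ++ [α]) ↔ S.Follows τ ∧ α.1 = S.act (S.dest τ) := by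
  constructor
  · intro h
    exact ⟨fun σ β hσ => h σ β (hσ.trans (List.prefix_append _ _)), h τ α (List.prefix_refl _)⟩
  · rintro ⟨h, hα⟩ σ β hσ
    rcases List.prefix_concat_iff.1 hσ with he | hp
    · obtain ⟨rfl, hβ⟩ := List.append_inj' he rfl
      obtain rfl : β = α := by simpa using hβ
      exact hα
    · exact h σ β hp

variable {S} in
theorem Follows.of_prefix {τ σ : List (Move Act D)} (h : S.Follows τ) (hσ : σ <+: τ) :
    S.Follows σ :=
  fun _ _ hρ => h _ _ (hρ.trans hσ)

/-- The node `v` is reached by a history that follows `S`. -/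
def Reachable (v : V) : Prop :=
  ∃ τ, S.Reaches τ v

variable {S} in
theorem Reaches.next {τ : List (Move Act D)} {v : V} (h : S.Reaches τ v) (d : D) :
    S.Reaches (τ ++ [(S.act v, d)]) (S.next v d) := by
  obtain ⟨h, rfl⟩ := h
  exact ⟨(S.follows_concat_iff _ _).2 ⟨h, rfl⟩, S.dest_concat _ _⟩

theorem reachable_init : S.Reachable S.init :=
  ⟨[], S.follows_nil, rfl⟩

variable {S} in
theorem Reachable.next {v : V} (h : S.Reachable v) (d : D) : S.Reachable (S.next v d) :=
  h.imp' _ fun _ hτ => hτ.next d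

/-- The d-state of a node that is reached consists of nodes that are reached. -/
theorem reachable_iff_of_eqvGen {G : DistributedGame N Act D Obs St} {u v : V}
    (h : Relation.EqvGen (S.ApproxUnion G) u v) : S.Reachable u ↔ S.Reachable v := by
  induction h with
  | rel u v h =>
    obtain ⟨i, τ, τ', -, hu, hv⟩ := h
    exact iff_of_true ⟨τ, hu⟩ ⟨τ', hv⟩
  | refl => exact Iff.rfl
  | symm _ _ _ ih => exact ih.symm
  | trans _ _ _ _ _ ih ih' => exact ih.trans ih'

end DecisionStructure

end History

/-! ### Well-foundedness and ranks for odd priorities -/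

section Rank

variable {α : Type*}

/-- The word `τ'` belongs to `H` and properly extends `τ`; the priorities of the prefixes from `τ`
on, without `τ'` itself, are at least `k`, and `k` is one of them. -/
def DropsTo (H : List α → Prop) (p : List α → ℕ) (k : ℕ) (τ' τ : List α) : Prop :=
  H τ' ∧ τ <+: τ' ∧ (∀ m, τ.length ≤ m → m < τ'.length → k ≤ p (τ'.take m)) ∧
    ∃ m, τ.length ≤ m ∧ m < τ'.length ∧ p (τ'.take m) = k

variable {H : List α → Prop} {p : List α → ℕ} {k : ℕ}

/-- A descending chain consists of ever longer prefixes of one play on which `k` recurs and, from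
the first prefix on, nothing smaller occurs. The least recurring priority would be the odd number
`k`. -/
theorem wellFounded_dropsTo (hH : ∀ σ τ, σ <+: τ → H τ → H σ) (hk : Odd k)
    (hp : ∀ π : ℕ → α, (∀ n, H ((List.range n).map π)) →
      ParityCondition fun n => p ((List.range n).map π)) :
    WellFounded (DropsTo H p k) := by
  rw [wellFounded_iff_isEmpty_descending_chain]
  refine ⟨fun ⟨f, hf⟩ => ?_⟩
  have hlen : StrictMono fun n => (f n).length := strictMono_nat_of_lt_succ fun n => by
    obtain ⟨-, -, -, m, h₁, h₂, -⟩ := hf n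
    exact h₁.trans_lt h₂
  have hid : ∀ n, n ≤ (f n).length := fun n => hlen.le_apply
  have hpre : ∀ m n, m ≤ n → f m <+: f n := fun m n h => by
    induction n, h using Nat.le_induction with
    | base => exact List.prefix_refl _
    | succ n _ ih => exact ih.trans (hf n).2.1
  -- The word `f (m + 1)` has length at least `m + 1`, so letter `m` of the limit play can be read
  -- off it.
  set π : ℕ → α := fun m => (f (m + 1))[m]'(hid (m + 1)) with hπ
  have htake : ∀ n m, m ≤ (f n).length → (List.range m).map π = (f n).take m := by
    intro n m hm
    refine List.ext_getElem (by simpa using hm) fun j h₁ h₂ => ?_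
    simp only [List.length_map, List.length_range] at h₁
    simp only [List.getElem_map, List.getElem_range, List.getElem_take, hπ]
    rcases le_total (j + 1) n with h | h
    · exact (hpre _ _ h).getElem _
    · exact ((hpre _ _ h).getElem _).symm
  obtain ⟨l, ⟨hl, hmin⟩, heven⟩ := hp π fun n => by
    rw [htake (n + 1) n (by have := hid (n + 1); omega)]
    exact hH _ _ (List.take_prefix _ _) (hf n).1
  have hfreq : l ≤ k := hmin <| by
    refine Filter.frequently_atTop.2 fun n => ?_
    obtain ⟨-, -, -, m, h₁, h₂, h₃⟩ := hf n
    exact ⟨m, (hid n).trans h₁, by simp only [htake (n + 1) m h₂.le, h₃]⟩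
  have hge : ∀ n m, (f 0).length ≤ m → m < (f n).length → k ≤ p ((List.range m).map π) := by
    intro n
    induction n with
    | zero => intro m h₁ h₂; omega
    | succ n ih =>
      intro m h₁ h₂
      rcases lt_or_ge m (f n).length with h | h
      · exact ih m h₁ h
      · rw [htake (n + 1) m h₂.le]
        exact (hf n).2.2.1 m h h₂
  obtain ⟨m, hm, hml⟩ := Filter.frequently_atTop.1 hl (f 0).length
  have := (hge (m + 1) m hm (hid (m + 1))).trans_eq hml
  obtain rfl : l = k := by omega
  exact Nat.not_even_iff_odd.2 hk heven

theorem dropsTo_concat {τ : List α} {a : α} (ha : H (τ ++ [a])) (hτ : p τ = k) :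
    DropsTo H p k (τ ++ [a]) τ := by
  have h : ∀ m, τ.length ≤ m → m < (τ ++ [a]).length → p ((τ ++ [a]).take m) = k := by
    intro m h₁ h₂
    obtain rfl : m = τ.length := by simp at h₂; omega
    simpa using hτ
  exact ⟨ha, List.prefix_append _ _, fun m h₁ h₂ => (h m h₁ h₂).ge,
    τ.length, le_rfl, by simp, h _ le_rfl (by simp)⟩

/-- This is why `DropsTo` spans whole segments instead of single moves: everything below the
extension is already below `τ`, so the rank cannot grow at priorities above `k`. -/
theorem DropsTo.of_concat {τ σ : List α} {a : α} (hτ : k ≤ p τ)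
    (h : DropsTo H p k σ (τ ++ [a])) : DropsTo H p k σ τ := by
  obtain ⟨hσ, hpre, hge, m, h₁, h₂, h₃⟩ := h
  have hpre' := (List.prefix_append τ [a]).trans hpre
  refine ⟨hσ, hpre', fun n hn hn' => ?_, m, by simp at h₁; omega, h₂, h₃⟩
  rcases hn.eq_or_lt with rfl | hlt
  · rwa [← List.prefix_iff_eq_take.1 hpre']
  · exact hge n (by simpa using hlt) hn'

end Rank

section Progress

variable {N : Type uN} {Act : N → Type uA} {D : Type uD} {V : Type*}

/-- If the parity condition holds on all plays through a structure with priorities on its nodes,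
then every odd priority `k` has an ordinal rank that does not increase on edges from nodes of
priority at least `k` and decreases on edges from nodes of priority `k`. -/
theorem DecisionStructure.exists_rank (S : DecisionStructure Act D V) (p : V → ℕ)
    (hp : ∀ π, S.IsPlay π → ParityCondition fun n => p (S.dest ((List.range n).map π)))
    {k : ℕ} (hk : Odd k) :
    ∃ ρ : V → Ordinal.{max (max uN uA) uD}, ∀ v d, S.Reachable v → k ≤ p v →
      ρ (S.next v d) ≤ ρ v ∧ (p v = k → ρ (S.next v d) < ρ v) := by
  have : IsWellFounded _ (DropsTo S.Follows (fun τ => p (S.dest τ)) k) :=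
    ⟨wellFounded_dropsTo (fun _ _ h h' => h'.of_prefix h) hk hp⟩
  set rk := IsWellFounded.rank (DropsTo S.Follows (fun τ => p (S.dest τ)) k) with hrk
  -- Histories that end in the same node may differ in rank, so the node takes the least one; an
  -- unreachable node gets the default `sInf ∅`.
  refine ⟨fun v => sInf (rk '' {τ | S.Reaches τ v}), fun v d hv hkv => ?_⟩
  -- The infimum is attained by some `τ`, whose extension by `d` bounds the rank of the next node.
  obtain ⟨τ, hτ, hmin⟩ :=
    csInf_mem (Set.Nonempty.image rk (s := {τ | S.Reaches τ v}) hv)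
  have hle := csInf_le' (Set.mem_image_of_mem rk
    (show τ ++ [(S.act v, d)] ∈ {τ | S.Reaches τ (S.next v d)} from hτ.next d))
  beta_reduce
  rw [← hmin]
  refine ⟨hle.trans ?_, fun he => hle.trans_lt <| IsWellFounded.rank_lt_of_rel <|
    dropsTo_concat (hτ.next d).1 (by rw [hτ.2, he])⟩
  rw [hrk, IsWellFounded.rank_eq]
  refine Ordinal.iSup_le fun ⟨σ, hσ⟩ => Order.succ_le_of_lt <| IsWellFounded.rank_lt_of_rel <|
    hσ.of_concat (by simpa only [hτ.2] using hkv)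

end Progress

/-- A sequence of priorities from a finite set satisfies the parity condition if each odd priority
that occurs is ranked by a sequence in a well-order that does not increase at priorities at
least `k` and decreases at priority `k`. -/
theorem parityCondition_of_rank {Q β : Type*} [Finite Q] [LinearOrder β] [WellFoundedLT β]
    (Ω : Q → ℕ) (s : ℕ → Q)
    (h : ∀ q, Odd (Ω q) → ∃ ρ : ℕ → β, ∀ n, Ω q ≤ Ω (s n) →
      ρ (n + 1) ≤ ρ n ∧ (Ω (s n) = Ω q → ρ (n + 1) < ρ n)) :
    ParityCondition fun n => Ω (s n) := by
  classical
  obtain ⟨q₀, hq₀⟩ : ∃ q, ∃ᶠ n in Filter.atTop, s n = q := by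
    by_contra! hc
    have hc' : ∀ᶠ n in Filter.atTop, ∀ q, s n ≠ q :=
      Filter.eventually_all.2 hc
    obtain ⟨n, hn⟩ := hc'.exists
    exact hn _ rfl
  have hex : ∃ k, ∃ᶠ n in Filter.atTop, Ω (s n) = k := ⟨Ω q₀, hq₀.mono fun n hn => by rw [hn]⟩
  set k := Nat.find hex with hkdef
  have hk : ∃ᶠ n in Filter.atTop, Ω (s n) = k := Nat.find_spec hex
  refine ⟨k, ⟨hk, fun l hl => Nat.find_min' hex hl⟩, ?_⟩
  by_contra hodd
  rw [Nat.not_even_iff_odd] at hodd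
  obtain ⟨n₀, hn₀⟩ := hk.exists
  obtain ⟨ρ, hρ⟩ := h (s n₀) (hn₀ ▸ hodd)
  rw [hn₀] at hρ
  have hev : ∀ᶠ n in Filter.atTop, k ≤ Ω (s n) := by
    have : ∀ᶠ n in Filter.atTop, ∀ l ∈ Set.Iio k, Ω (s n) ≠ l :=
      (Filter.eventually_all_finite (Set.finite_Iio k)).2 fun l hl =>
        Filter.not_frequently.1 (Nat.find_min hex hl)
    exact this.mono fun n hn => not_lt.1 fun hlt => hn _ hlt rfl
  obtain ⟨m, hm⟩ := Filter.eventually_atTop.1 hev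
  have hanti : Antitone fun n => ρ (m + n) := antitone_nat_of_succ_le fun n =>
    (hρ (m + n) (hm _ (by omega))).1
  -- Beyond `m` the rank never rises; the next visit to `k` after its minimum, at `m + j`, pushes it
  -- below that minimum.
  obtain ⟨_, ⟨j, rfl⟩, hj⟩ := WellFounded.has_min (wellFounded_lt (α := β))
    (Set.range fun n => ρ (m + n)) ⟨_, 0, rfl⟩
  obtain ⟨n, hn, hnk⟩ := Filter.frequently_atTop.1 hk (m + j)
  obtain ⟨i, rfl⟩ := Nat.exists_eq_add_of_le (show m ≤ n by omega)
  refine hj _ ⟨i + 1, rfl⟩ (lt_of_lt_of_le ((hρ (m + i) (hm _ (by omega))).2 hnk) ?_)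
  exact hanti (by omega)

/-! ### Retracts of an annotated strategy -/

namespace AnnotatedStrategy

variable {N : Type uN} {Act : N → Type uA} {D : Type uD} {Q V V' : Type*} {Obs St : N → Type*}
  {G : DistributedGame N Act D Obs St} {W : ParityTreeAutomaton Act D Q}

/-- The structure that moves along an edge of `S` and then by `ι ∘ r`. -/
def retract (S : AnnotatedStrategy G W V) (ι : V' → V) (r : V → V') :
    DecisionStructure Act D V' where
  next x d := r (S.next (ι x) d)
  act x := S.act (ι x)
  init := r S.init

variable (S : AnnotatedStrategy G W V) {ι : V' → V} {r : V → V'}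

theorem obsLabel_next {v : V} (hv : S.Reachable v) (i : N) (d : D) :
    S.obsLabel i (S.next v d) = (G.machine i).step (S.obsLabel i v) (S.act v, d) := by
  obtain ⟨τ, hτ⟩ := hv
  have h := S.obsLabel_run i _ (hτ.next d).1
  rw [(hτ.next d).2, MealyMachine.state_concat, ← S.obsLabel_run i τ hτ.1, hτ.2] at h
  exact h

/-- The next output depends only on the move and the machine state, which the node records, so any
histories witnessing `h` can be extended. -/
theorem approx_next {i : N} {u v : V} (h : S.Approx G i u v) {d d' : D}
    (ho : (G.machine i).out (S.obsLabel i u) (S.act u, d) =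
      (G.machine i).out (S.obsLabel i v) (S.act v, d')) :
    S.Approx G i (S.next u d) (S.next v d') := by
  obtain ⟨τ, τ', hi, hu, hv⟩ := h
  refine ⟨_, _, (G.indist_concat_iff i _ _ _ _).2 ⟨hi, ?_⟩, hu.next d, hv.next d'⟩
  rw [← S.obsLabel_run i τ hu.1, ← S.obsLabel_run i τ' hv.1, hu.2, hv.2]
  exact ho

theorem reachable_retract (hr : ∀ v, S.Reachable v → S.Reachable (ι (r v)))
    (τ : List (Move Act D)) : S.Reachable (ι ((S.retract ι r).dest τ)) := by
  induction τ using List.reverseRecOn with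
  | nil => exact hr _ S.reachable_init
  | append_singleton τ α ih =>
    rw [DecisionStructure.dest_concat]
    exact hr _ (ih.next _)

theorem obsLabel_retract (hr : ∀ v, S.Reachable v → S.Reachable (ι (r v)))
    (hobs : ∀ i v, S.Reachable v → S.obsLabel i (ι (r v)) = S.obsLabel i v)
    (i : N) (τ : List (Move Act D)) (hτ : (S.retract ι r).Follows τ) :
    S.obsLabel i (ι ((S.retract ι r).dest τ)) = (G.machine i).state τ := by
  induction τ using List.reverseRecOn with
  | nil => exact (hobs i _ S.reachable_init).trans (S.obsLabel_run i [] S.follows_nil)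
  | append_singleton τ α ih =>
    obtain ⟨hτ, hα⟩ := (DecisionStructure.follows_concat_iff _ _ _).1 hτ
    have hreach := S.reachable_retract hr τ
    rw [DecisionStructure.dest_concat, MealyMachine.state_concat, ← ih hτ]
    refine (hobs i _ (hreach.next _)).trans ((S.obsLabel_next hreach i α.2).trans ?_)
    congr 1
    exact Prod.ext hα.symm rfl

/-- A history of the retract need not lead to the same node in `S`. The invariant only asks for some
histories of `S` that relate the end nodes; extending them and then jumping supplies new ones. -/
theorem approx_retract (hr : ∀ v, S.Reachable v → S.Reachable (ι (r v)))
    (hobs : ∀ i v, S.Reachable v → S.obsLabel i (ι (r v)) = S.obsLabel i v)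
    (happrox : ∀ i u v, S.Approx G i u v → S.Approx G i (ι (r u)) (ι (r v)))
    (i : N) (τ τ' : List (Move Act D)) (hτ : (S.retract ι r).Follows τ)
    (hτ' : (S.retract ι r).Follows τ') (hi : G.Indist i τ τ') :
    S.Approx G i (ι ((S.retract ι r).dest τ)) (ι ((S.retract ι r).dest τ')) := by
  induction τ using List.reverseRecOn generalizing τ' with
  | nil =>
    rcases List.eq_nil_or_concat τ' with rfl | ⟨τ', α', rfl⟩
    · exact happrox i _ _ ⟨[], [], rfl, ⟨S.follows_nil, rfl⟩, ⟨S.follows_nil, rfl⟩⟩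
    -- Outputs are as long as their inputs, so only the empty history is indistinguishable from
    -- itself.
    · rw [List.concat_eq_append, DistributedGame.Indist, MealyMachine.output_concat] at hi
      simp [MealyMachine.output, MealyMachine.outputFrom] at hi
  | append_singleton τ α ih =>
    rcases List.eq_nil_or_concat τ' with rfl | ⟨τ', α', rfl⟩
    · rw [DistributedGame.Indist, MealyMachine.output_concat] at hi
      simp [MealyMachine.output, MealyMachine.outputFrom] at hi
    · rw [List.concat_eq_append] at hi hτ' ⊢
      obtain ⟨hτ, hα⟩ := (DecisionStructure.follows_concat_iff _ _ _).1 hτ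
      obtain ⟨hτ', hα'⟩ := (DecisionStructure.follows_concat_iff _ _ _).1 hτ'
      obtain ⟨hi, ho⟩ := (G.indist_concat_iff i _ _ _ _).1 hi
      rw [DecisionStructure.dest_concat, DecisionStructure.dest_concat]
      refine happrox i _ _ (S.approx_next (ih τ' hτ hτ' hi) ?_)
      rw [S.obsLabel_retract hr hobs i τ hτ, S.obsLabel_retract hr hobs i τ' hτ']
      convert ho using 2
      · exact Prod.ext hα.symm rfl
      · exact Prod.ext hα'.symm rfl

theorem isStrategy_retract (hr : ∀ v, S.Reachable v → S.Reachable (ι (r v)))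
    (hobs : ∀ i v, S.Reachable v → S.obsLabel i (ι (r v)) = S.obsLabel i v)
    (happrox : ∀ i u v, S.Approx G i u v → S.Approx G i (ι (r u)) (ι (r v))) :
    (S.retract ι r).IsStrategy G := by
  rintro i _ _ ⟨τ, τ', hi, ⟨hτ, rfl⟩, ⟨hτ', rfl⟩⟩
  exact S.uniform i _ _ (S.approx_retract hr hobs happrox i τ τ' hτ hτ' hi)

theorem isRun_retract (hr : ∀ v, S.Reachable v → S.Reachable (ι (r v)))
    (haut : ∀ v, S.Reachable v → S.autLabel (ι (r v)) = S.autLabel v) :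
    W.IsRun (S.retract ι r) fun τ => S.autLabel (ι ((S.retract ι r).dest τ)) := by
  refine ⟨(haut _ S.reachable_init).trans S.autLabel_run.1, fun τ _ => ?_⟩
  have hreach := S.reachable_retract hr τ
  -- The transition is borrowed from any history `σ` of `S` that reaches the same node.
  obtain ⟨σ, hσ, hdest⟩ := id hreach
  have h := S.autLabel_run.2 σ hσ
  simp only [DecisionStructure.dest_concat, hdest] at h ⊢
  have heq := funext fun d => haut _ (hreach.next d)
  exact heq.symm ▸ h

theorem isWinning_retract [Finite Q] (hr : ∀ v, S.Reachable v → S.Reachable (ι (r v)))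
    (haut : ∀ v, S.Reachable v → S.autLabel (ι (r v)) = S.autLabel v)
    {β : Type*} [LinearOrder β] [WellFoundedLT β] (ρ : Q → V → β)
    (hρ : ∀ q, Odd (W.priority q) → ∀ v d, S.Reachable v →
      W.priority q ≤ W.priority (S.autLabel v) → ρ q (S.next v d) ≤ ρ q v ∧
        (W.priority (S.autLabel v) = W.priority q → ρ q (S.next v d) < ρ q v))
    (hrank : ∀ q v, S.Reachable v → ρ q (ι (r v)) ≤ ρ q v) :
    W.IsWinning (S.retract ι r) := by
  refine ⟨_, S.isRun_retract hr haut, fun π _ => ?_⟩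
  refine parityCondition_of_rank W.priority _ fun q hq =>
    ⟨fun n => ρ q (ι ((S.retract ι r).dest ((List.range n).map π))), fun n hn => ?_⟩
  have hreach := S.reachable_retract hr ((List.range n).map π)
  obtain ⟨h₁, h₂⟩ := hρ q hq _ (π n).2 hreach hn
  have hle := hrank q _ (hreach.next (π n).2)
  simp only [List.range_succ, List.map_append, List.map_cons, List.map_nil,
    DecisionStructure.dest_concat]
  exact ⟨hle.trans h₁, fun he => hle.trans_lt (h₂ he)⟩

/-- Finite d-states with finitely many isomorphism types are well-quasi-ordered by isomorphisms
that do not increase given ranks of the nodes, so finitely many of them lie below all. -/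
theorem exists_finite_basis {β ι : Type*} [LinearOrder β] [WellFoundedLT β] [Finite ι]
    (ρ : ι → V → β) (hfin : ∀ K ∈ S.dStates G, K.Finite) (hidx : S.FiniteIndex)
    (P : S.dStates G → Prop) :
    ∃ F : Finset (S.dStates G), (∀ L ∈ F, P L) ∧ ∀ K, P K → ∃ L ∈ F, ∃ e : S.Iso K.1 L.1,
      ∀ q (u : K.1), ρ q (e.toEquiv u) ≤ ρ q u := by
  by_contra! hc
  -- Without a finite basis there is an infinite sequence in which every isomorphism from a later
  -- d-state to an earlier one raises some rank.
  obtain ⟨f, -, hf⟩ := exists_seq_of_forall_finset_exists P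
    (fun L K => ∀ e : S.Iso K.1 L.1, ∃ q, ∃ u : K.1, ρ q u < ρ q (e.toEquiv u))
    fun F hF => hc F hF
  have : Finite (Quotient S.isoSetoid) := hidx
  obtain ⟨c, hc⟩ := Finite.exists_infinite_fiber
    fun n => (Quotient.mk S.isoSetoid (f n))
  obtain ⟨g, hg, hgc⟩ := Nat.exists_strictMono_subsequence fun n =>
    ((Set.infinite_coe_iff.1 hc).exists_gt n).imp fun _ h => h.symm
  obtain ⟨K, rfl⟩ := Quotient.exists_rep c
  have hiso : ∀ n, Nonempty (S.Iso K.1 (f (g n)).1) := fun n =>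
    S.isoSetoid.symm (Quotient.exact (hgc n))
  let e := fun n => (hiso n).some
  have := (hfin K.1 K.2).to_subtype
  -- Dickson's lemma for well-orders, applied to the rank vectors pulled back to the common finite
  -- d-state `K`.
  obtain ⟨m, n, hmn, hle⟩ := (wellQuasiOrdered_le (α := K.1 × ι → β))
    fun n x => ρ x.2 ((e n).toEquiv x.1)
  obtain ⟨e', he'⟩ : ∃ e' : S.Iso (f (g n)).1 (f (g m)).1,
      ∀ u, e'.toEquiv ((e n).toEquiv u) = (e m).toEquiv u := by
    refine ⟨⟨(e n).toEquiv.symm.trans (e m).toEquiv, fun u v d => ?_, fun i u v => ?_,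
      fun i u => ?_, fun u => ?_⟩, fun u => by simp⟩ <;>
    obtain ⟨u, rfl⟩ := (e n).toEquiv.surjective u
    · obtain ⟨v, rfl⟩ := (e n).toEquiv.surjective v
      simpa using ((e n).edge_iff u v d).symm.trans ((e m).edge_iff u v d)
    · obtain ⟨v, rfl⟩ := (e n).toEquiv.surjective v
      simpa using ((e n).approx_iff i u v).symm.trans ((e m).approx_iff i u v)
    · simpa using ((e m).obsLabel_eq i u).trans ((e n).obsLabel_eq i u).symm
    · simpa using ((e m).autLabel_eq u).trans ((e n).autLabel_eq u).symm
  obtain ⟨q, u, hlt⟩ := hf _ _ (hg hmn) e'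
  obtain ⟨u, rfl⟩ := (e n).toEquiv.surjective u
  rw [he'] at hlt
  exact hlt.not_ge (hle (u, q))

/-! ### Construction of the finite retract -/

theorem approxUnion_of_approx {i : N} {u v : V} (h : S.Approx G i u v) :
    Relation.EqvGen (S.ApproxUnion G) u v :=
  .rel _ _ ⟨i, h⟩

/-- The d-state of a node. -/
def dState (v : V) : S.dStates G :=
  ⟨{u | Relation.EqvGen (S.ApproxUnion G) u v}, v, rfl⟩

theorem dState_eq {K : S.dStates G} {v : V} (hv : v ∈ K.1) : S.dState v = K := by
  obtain ⟨K, w, rfl⟩ := K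
  refine Subtype.ext (Set.ext fun u => ?_)
  exact ⟨fun h => h.trans _ _ _ hv, fun h => h.trans _ _ _ (.symm _ _ hv)⟩

theorem mem_dState (v : V) : v ∈ (S.dState v).1 :=
  Relation.EqvGen.refl v

theorem exists_retraction [Finite Q] (hS : S.IsWitness) (hfin : ∀ K ∈ S.dStates G, K.Finite)
    (hidx : S.FiniteIndex) :
    ∃ (n : ℕ) (ι : Fin n → V) (r : V → Fin n), (S.retract ι r).IsStrategy G ∧
      W.IsWinning (S.retract ι r) := by
  have hex : ∀ q, ∃ ρ : V → Ordinal.{max (max uN uA) uD}, Odd (W.priority q) → ∀ v d, S.Reachable v →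
      W.priority q ≤ W.priority (S.autLabel v) → ρ (S.next v d) ≤ ρ v ∧
        (W.priority (S.autLabel v) = W.priority q → ρ (S.next v d) < ρ v) := fun q => by
    by_cases hq : Odd (W.priority q)
    · obtain ⟨ρ, hρ⟩ := S.exists_rank (fun v => W.priority (S.autLabel v)) hS.2 hq
      exact ⟨ρ, fun _ => hρ⟩
    · exact ⟨0, fun h => absurd h hq⟩
  choose ρ hρ using hex
  -- Ranks are controlled only at reachable nodes, so the jumps must land in d-states that consist
  -- of such nodes.
  obtain ⟨F, hF, hbasis⟩ := S.exists_finite_basis ρ hfin hidx fun K => ∀ v ∈ K.1, S.Reachable v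
  choose! L hLF e he using hbasis
  classical
  have hmem : ∀ v, S.Reachable v → ∀ u ∈ (S.dState v).1, S.Reachable u := fun v hv u hu =>
    (S.reachable_iff_of_eqvGen hu).2 hv
  let U : Set V := ⋃ K ∈ F, K.1
  let r' : ∀ v, S.Reachable v → U := fun v hv =>
    ⟨(e (S.dState v) (hmem v hv)).toEquiv ⟨v, S.mem_dState v⟩,
      Set.mem_biUnion (hLF _ (hmem v hv)) (Subtype.coe_prop _)⟩
  -- The value at unreachable nodes is arbitrary: paths of the retract never use it.
  let r : V → U := fun v => if hv : S.Reachable v then r' v hv else r' S.init S.reachable_init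
  have : Finite U := F.finite_toSet.biUnion fun K _ => hfin K.1 K.2
  obtain ⟨n, ⟨φ⟩⟩ := Finite.exists_equiv_fin U
  let ι : Fin n → V := fun x => φ.symm x
  have hr : ∀ (K : S.dStates G) (hK : ∀ v ∈ K.1, S.Reachable v) (v : K.1),
      ι (φ (r v)) = (e K hK).toEquiv v := by
    rintro K hK ⟨v, hv⟩
    obtain rfl := S.dState_eq hv
    simp only [ι, Equiv.symm_apply_apply, r, dif_pos (hK v hv), r']
  have hr' : ∀ v (hv : S.Reachable v),
      ι (φ (r v)) = (e (S.dState v) (hmem v hv)).toEquiv ⟨v, S.mem_dState v⟩ :=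
    fun v hv => hr _ (hmem v hv) ⟨v, S.mem_dState v⟩
  have hreach : ∀ v, S.Reachable v → S.Reachable (ι (φ (r v))) := fun v hv => by
    rw [hr' v hv]
    exact hF _ (hLF _ (hmem v hv)) _ (Subtype.coe_prop _)
  refine ⟨n, ι, fun v => φ (r v), S.isStrategy_retract hreach (fun i v hv => ?_) fun i u v h => ?_,
    S.isWinning_retract hreach (fun v hv => ?_) ρ hρ fun q v hv => ?_⟩
  · rw [hr' v hv]
    exact (e _ _).obsLabel_eq i _
  · have hv : S.Reachable v := by
      obtain ⟨τ, τ', -, -, hv⟩ := h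
      exact ⟨τ', hv⟩
    -- Since `u` lies in the d-state of `v`, one and the same isomorphism moves both nodes.
    rw [hr' v hv, hr _ (hmem v hv) ⟨u, S.approxUnion_of_approx h⟩]
    exact ((e _ _).approx_iff i _ _).1 h
  · rw [hr' v hv]
    exact (e _ _).autLabel_eq _
  · rw [hr' v hv]
    exact he _ (hmem v hv) q _

end AnnotatedStrategy

theorem mainTheorem1 {N : Type*} [Finite N] {Act : N → Type*} [∀ i, Finite (Act i)]
    {D : Type*} [Finite D] {Obs St : N → Type*} [∀ i, Finite (Obs i)] [∀ i, Finite (St i)]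
    {Q : Type*} [Finite Q]
    (G : DistributedGame N Act D Obs St) (W : ParityTreeAutomaton Act D Q)
    (hwitness : ∃ (V : Type u) (S : AnnotatedStrategy G W V),
      S.IsWitness ∧ (∀ K ∈ S.dStates G, K.Finite) ∧ S.FiniteIndex) :
    ∃ (V' : Type) (S' : DecisionStructure Act D V'),
      Finite V' ∧ S'.IsStrategy G ∧ W.IsWinning S' := by
  obtain ⟨V, S, hS, hfin, hidx⟩ := hwitness
  obtain ⟨n, ι, r, hstrategy, hwinning⟩ := S.exists_retraction hS hfin hidx
  exact ⟨Fin n, S.retract ι r, inferInstance, hstrategy, hwinning⟩
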